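/- Let $K$ be a field of characteristic $0$ that is complete with respect to a nontrivial non-archimedean absolute value $|\cdot|$. A power series $f(x)=\sum_k a_kx^k\in K[[x]]$ is called analytic if its radius of convergence $\rho=\left(\limsup_{k\to\infty}|a_k|^{1/k}\right)^{-1}$ is positive, and tangent to the identity if $f(x)=x+O(x^2)$. Let $m\ge 2$ be an integer, let $\mu\in K$, and let $$f(x)=x+x^m+\mu x^{2m-1}+\sum_{k\ge 2m}a_kx^k\in K[[x]]$$ be analytic. Then for every integer $n\ge 1$ there is a unique analytic power series $g\in K[[x]]$ tangent to the identity such that $g^{\circ n}=f$, where $g^{\circ n}=g\circ\cdots\circ g$ is the $n$-th iterate of $g$ under composition. -/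

import Mathlib

open Filter

namespace NonarchRoots

/-- The radius of convergence about `0` of a power series `∑ aₙ xⁿ` over a normed field,
`ρ = (limsup |aₙ|^(1/n))⁻¹`, as an extended nonnegative real number. -/
noncomputable def radius {K : Type*} [NormedField K] (f : PowerSeries K) : ENNReal :=
  (limsup (fun n : ℕ => ‖PowerSeries.coeff n f‖ₑ ^ (1 / (n : ℝ))) atTop)⁻¹

/-- A power series is locally analytic at `0` if its radius of convergence is positive. -/
def IsLocallyAnalytic {K : Type*} [NormedField K] (f : PowerSeries K) : Prop :=
  0 < radius f

/-- `f` is tangent to the identity: `f(x) = x + O(x²)`. -/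
def IsTangentToId {K : Type*} [CommRing K] (f : PowerSeries K) : Prop :=
  PowerSeries.coeff 0 f = 0 ∧ PowerSeries.coeff 1 f = 1

/-- `f` has the form `x + x^m + μ x^(2m-1) + ∑_{n ≥ 2m} aₙ xⁿ`. -/
def HasReducedForm {K : Type*} [CommRing K] (m : ℕ) (μ : K) (f : PowerSeries K) : Prop :=
  ∃ r : PowerSeries K,
    f = PowerSeries.X + PowerSeries.X ^ m + PowerSeries.C μ * PowerSeries.X ^ (2 * m - 1)
      + PowerSeries.X ^ (2 * m) * r

/-- Composition `f ∘ g` of formal power series, `x ↦ f(g(x))`, meaningful when `g(0) = 0`. -/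
noncomputable def comp {K : Type*} [CommRing K] (f g : PowerSeries K) : PowerSeries K :=
  PowerSeries.subst g f

/-- The `n`-th iterate `g ∘ ⋯ ∘ g` under composition; the `0`-th iterate is `x`. -/
noncomputable def compIter {K : Type*} [CommRing K] (g : PowerSeries K) : ℕ → PowerSeries K
  | 0 => PowerSeries.X
  | n + 1 => comp g (compIter g n)

end NonarchRoots

/-! Put Δφ = φ ∘ f - φ. Newton's formula f^{∘t} = ∑ₖ binom(t, k) Δᵏ X defines iterates for every t
in K: Δ raises orders, so each coefficient is a polynomial in t. Identities between iterates extend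
from natural t to all t, since K is infinite of characteristic 0; t = 1/n then gives the formal root
and its uniqueness (`compIter_flowAt`, `eq_flowAt_of_compIter_eq`). For convergence, f maps a small
disc into itself, so by the ultrametric inequality Δ does not increase the norm there, while 1/k!
grows at most geometrically (`isLocallyAnalytic_flowAt`). -/

namespace NonarchRoots

open PowerSeries

/-! ### Iteration and the difference operator -/

section Formal

variable {R : Type*} [CommRing R]

lemma hasSubst_of_coeff_zero {f : R⟦X⟧} (hf : coeff 0 f = 0) : HasSubst f :=
  HasSubst.of_constantCoeff_zero' (by simpa using hf)

lemma coeff_zero_comp {f g : R⟦X⟧} (hf : coeff 0 f = 0) (hg : coeff 0 g = 0) :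
    coeff 0 (comp f g) = 0 := by
  rw [coeff_zero_eq_constantCoeff_apply] at *
  exact constantCoeff_subst_eq_zero hg f hf

lemma comp_assoc {f g h : R⟦X⟧} (hg : coeff 0 g = 0) (hh : coeff 0 h = 0) :
    comp (comp f g) h = comp f (comp g h) :=
  subst_comp_subst_apply (hasSubst_of_coeff_zero hg) (hasSubst_of_coeff_zero hh) f

lemma comp_X (f : R⟦X⟧) : comp f X = f := X_subst f

lemma X_comp {f : R⟦X⟧} (hf : coeff 0 f = 0) : comp X f = f :=
  subst_X (hasSubst_of_coeff_zero hf)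

lemma coeff_zero_compIter {f : R⟦X⟧} (hf : coeff 0 f = 0) (n : ℕ) :
    coeff 0 (compIter f n) = 0 := by
  induction n with
  | zero => simp [compIter]
  | succ n ih => exact coeff_zero_comp hf ih

lemma compIter_add {f : R⟦X⟧} (hf : coeff 0 f = 0) (i j : ℕ) :
    compIter f (i + j) = comp (compIter f i) (compIter f j) := by
  induction i with
  | zero => simp [compIter, X_comp (coeff_zero_compIter hf j)]
  | succ i ih =>
    rw [Nat.succ_add]
    simp only [compIter]
    rw [ih, comp_assoc (coeff_zero_compIter hf i) (coeff_zero_compIter hf j)]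

lemma compIter_one (f : R⟦X⟧) : compIter f 1 = f := by
  simp [compIter, comp_X]

lemma compIter_mul {f : R⟦X⟧} (hf : coeff 0 f = 0) (i j : ℕ) :
    compIter f (i * j) = compIter (compIter f i) j := by
  induction j with
  | zero => simp [compIter]
  | succ j ih => rw [Nat.mul_succ, add_comm, compIter_add hf, ih]; rfl

lemma map_compIter {S : Type*} [CommRing S] (φ : R →+* S) {f : R⟦X⟧} (hf : coeff 0 f = 0)
    (n : ℕ) : map φ (compIter f n) = compIter (map φ f) n := by
  induction n with
  | zero => simp [compIter]
  | succ n ih =>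
    simp only [compIter]
    rw [← ih]
    exact map_subst (hasSubst_of_coeff_zero (coeff_zero_compIter hf n)) f

/-- The operator `φ ↦ φ ∘ f`. -/
noncomputable def compLinear {f : R⟦X⟧} (hf : coeff 0 f = 0) : R⟦X⟧ →ₗ[R] R⟦X⟧ :=
  (substAlgHom (hasSubst_of_coeff_zero hf)).toLinearMap

lemma compLinear_apply {f : R⟦X⟧} (hf : coeff 0 f = 0) (φ : R⟦X⟧) :
    compLinear hf φ = comp φ f := by
  simp [compLinear, comp, coe_substAlgHom]

/-- The difference operator `φ ↦ φ ∘ f - φ`. -/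
noncomputable def diffOp {f : R⟦X⟧} (hf : coeff 0 f = 0) : Module.End R R⟦X⟧ :=
  compLinear hf - 1

lemma diffOp_apply {f : R⟦X⟧} (hf : coeff 0 f = 0) (φ : R⟦X⟧) :
    diffOp hf φ = comp φ f - φ := by
  simp [diffOp, compLinear_apply]

/-- Binomial expansion of (1 + Δ)ⁿ, where 1 + Δ is composition with f. -/
lemma compIter_eq_sum {f : R⟦X⟧} (hf : coeff 0 f = 0) (n : ℕ) :
    compIter f n = ∑ k ∈ Finset.range (n + 1), (n.choose k : R) • ((diffOp hf) ^ k) X := by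
  have h1 : compIter f n = ((diffOp hf + 1) ^ n) X := by
    induction n with
    | zero => simp [compIter]
    | succ n ih =>
      rw [compIter_add hf, compIter_one, ih, pow_succ']
      simp [diffOp_apply]
  rw [h1, (Commute.one_right _).add_pow, LinearMap.sum_apply]
  refine Finset.sum_congr rfl fun k _ => ?_
  rw [one_pow, mul_one, ← nsmul_eq_mul', LinearMap.smul_apply, Nat.cast_smul_eq_nsmul]

/-- Writing f = X u with u(0) = 1 shows that φ ∘ f and φ have the same leading term. -/
lemma X_pow_succ_dvd_diffOp {f : R⟦X⟧} (hf : IsTangentToId f) {k : ℕ} {φ : R⟦X⟧}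
    (h : X ^ (k + 1) ∣ φ) : X ^ (k + 2) ∣ diffOp hf.1 φ := by
  obtain ⟨ψ, rfl⟩ := h
  have hs := hasSubst_of_coeff_zero hf.1
  obtain ⟨u, hu⟩ : X ∣ f := X_dvd_iff.2 (by simpa using hf.1)
  have hu0 : constantCoeff u = 1 := by
    have := hf.2
    rw [hu, ← zero_add 1, coeff_succ_X_mul] at this
    simpa using this
  have hX : X ∣ u ^ (k + 1) * comp ψ f - ψ := by
    rw [X_dvd_iff, map_sub, map_mul, map_pow, hu0, one_pow, one_mul, sub_eq_zero]
    have hψ : X ∣ ψ - C (constantCoeff ψ) := by simp [X_dvd_iff]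
    obtain ⟨χ, hχ⟩ := hψ
    rw [sub_eq_iff_eq_add] at hχ
    have : comp ψ f = f * comp χ f + C (constantCoeff ψ) := by
      conv_lhs => rw [hχ]
      simp only [comp]
      rw [subst_add hs, subst_mul hs, subst_X hs, subst_C]
      rfl
    rw [this]
    have h0 : constantCoeff f = 0 := by simpa using hf.1
    simp [h0]
  have h2 : diffOp hf.1 (X ^ (k + 1) * ψ) = X ^ (k + 1) * (u ^ (k + 1) * comp ψ f - ψ) := by
    rw [diffOp_apply]
    have : comp (X ^ (k + 1) * ψ) f = f ^ (k + 1) * comp ψ f := by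
      simp only [comp]
      rw [subst_mul hs, subst_pow hs, subst_X hs]
    rw [this]
    nth_rw 1 [hu]
    ring
  rw [h2, pow_succ X (k + 1)]
  exact mul_dvd_mul_left _ hX

lemma coeff_diffOp_pow_X_eq_zero {f : R⟦X⟧} (hf : IsTangentToId f) {i k : ℕ} (h : i ≤ k) :
    coeff i ((diffOp hf.1 ^ k) X) = 0 := by
  have : X ^ (k + 1) ∣ (diffOp hf.1 ^ k) X := by
    induction k generalizing i with
    | zero => simp
    | succ k ih =>
      rw [pow_succ' (diffOp hf.1), Module.End.mul_apply]
      exact X_pow_succ_dvd_diffOp hf (ih (Nat.zero_le k))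
  exact X_pow_dvd_iff.1 this i (by omega)

end Formal

/-! ### Iterates at arbitrary times -/

section Flow

variable {K : Type*} [Field K]

/-- The power series over `K[T]` whose value at a natural number `j` is the `j`-th iterate
of `f`. -/
noncomputable def flow {f : K⟦X⟧} (hf : coeff 0 f = 0) : (Polynomial K)⟦X⟧ :=
  -- For f tangent to the identity, stopping at k < i loses nothing: Δᵏ X has order above k.
  PowerSeries.mk fun i => ∑ k ∈ Finset.range i,
    Polynomial.C (coeff i ((diffOp hf ^ k) X) / (k.factorial : K)) * descPochhammer K k

lemma coeff_zero_flow {f : K⟦X⟧} (hf : coeff 0 f = 0) : coeff 0 (flow hf) = 0 := by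
  simp [flow]

/-- The specialization of the flow at time `t`. -/
noncomputable def flowAt {f : K⟦X⟧} (hf : coeff 0 f = 0) (t : K) : K⟦X⟧ :=
  map (Polynomial.evalRingHom t) (flow hf)

lemma coeff_flowAt {f : K⟦X⟧} (hf : coeff 0 f = 0) (t : K) (i : ℕ) :
    coeff i (flowAt hf t) = ∑ k ∈ Finset.range i,
      coeff i ((diffOp hf ^ k) X) / (k.factorial : K) * (descPochhammer K k).eval t := by
  simp [flowAt, flow]

lemma isTangentToId_flowAt {f : K⟦X⟧} (hf : coeff 0 f = 0) (t : K) :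
    IsTangentToId (flowAt hf t) := by
  constructor <;> simp [coeff_flowAt]

variable [CharZero K]

lemma flowAt_natCast {f : K⟦X⟧} (hf : IsTangentToId f) (n : ℕ) :
    flowAt hf.1 (n : K) = compIter f n := by
  ext i
  rw [coeff_flowAt, compIter_eq_sum hf.1, map_sum]
  have e : ∀ k, coeff i ((diffOp hf.1 ^ k) X) / (k.factorial : K) *
      (descPochhammer K k).eval (n : K) = (n.choose k : K) * coeff i ((diffOp hf.1 ^ k) X) := by
    intro k
    rw [descPochhammer_eval_eq_descFactorial, Nat.descFactorial_eq_factorial_mul_choose]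
    have : (k.factorial : K) ≠ 0 := Nat.cast_ne_zero.2 k.factorial_ne_zero
    push_cast
    field_simp
  simp only [e, map_smul, smul_eq_mul]
  -- Both sums are extended to a common range: the added terms vanish by the order of Δᵏ X on one
  -- side and by binom(n, k) = 0 on the other.
  rw [Finset.sum_subset (Finset.range_mono (Nat.le_max_left i (n + 1))),
    ← Finset.sum_subset (Finset.range_mono (Nat.le_max_right i (n + 1)))]
  · intro k _ hk
    rw [Nat.choose_eq_zero_of_lt (by simpa using hk), Nat.cast_zero, zero_mul]
  · intro k _ hk
    rw [coeff_diffOp_pow_X_eq_zero hf (by simpa using hk), mul_zero]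

lemma polynomial_ext_natCast {p q : Polynomial K} (h : ∀ n : ℕ, p.eval (n : K) = q.eval (n : K)) :
    p = q :=
  Polynomial.eq_of_infinite_eval_eq p q <|
    (Set.infinite_range_of_injective (Nat.cast_injective (R := K))).mono <| by
      rintro _ ⟨n, rfl⟩
      exact h n

/-- Over K[T], both sides specialize at T = j to the iterate of f of order jn. -/
lemma compIter_flowAt {f : K⟦X⟧} (hf : IsTangentToId f) (t : K) (n : ℕ) :
    compIter (flowAt hf.1 t) n = flowAt hf.1 (t * n) := by
  have h : compIter (flow hf.1) n =
      map (Polynomial.compRingHom (Polynomial.X * (n : Polynomial K))) (flow hf.1) := by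
    ext1 i
    refine polynomial_ext_natCast fun j => ?_
    have h1 : coeff i (map (Polynomial.evalRingHom (j : K)) (compIter (flow hf.1) n)) =
        coeff i (flowAt hf.1 ((j * n : ℕ) : K)) := by
      rw [map_compIter _ (coeff_zero_flow hf.1), flowAt_natCast hf, compIter_mul hf.1,
        ← flowAt_natCast hf j]
      rfl
    simpa [flowAt, Polynomial.eval_comp] using h1
  have h2 := congrArg (PowerSeries.map (Polynomial.evalRingHom t)) h
  rw [map_compIter _ (coeff_zero_flow hf.1)] at h2
  refine h2.trans ?_
  ext i
  simp [flowAt, Polynomial.eval_comp]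

/-- The flow of g at time nT equals the flow of f at time T, as seen at natural T; now set T = 1/n.
-/
lemma eq_flowAt_of_compIter_eq {f g : K⟦X⟧} (hf : IsTangentToId f) (hg : IsTangentToId g) {n : ℕ}
    (hn : n ≠ 0) (h : compIter g n = f) : g = flowAt hf.1 (1 / (n : K)) := by
  have hn' : (n : K) ≠ 0 := Nat.cast_ne_zero.2 hn
  have key : map (Polynomial.compRingHom ((n : Polynomial K) * Polynomial.X)) (flow hg.1) =
      flow hf.1 := by
    ext1 i
    refine polynomial_ext_natCast fun j => ?_
    have h1 : coeff i (flowAt hg.1 ((n * j : ℕ) : K)) = coeff i (flowAt hf.1 (j : K)) := by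
      rw [flowAt_natCast hg, flowAt_natCast hf, compIter_mul hg.1, h]
    simpa [flowAt, Polynomial.eval_comp] using h1
  have h2 : flowAt hf.1 (1 / (n : K)) = flowAt hg.1 ((1 : ℕ) : K) := by
    rw [flowAt, ← key]
    ext i
    simp [flowAt, Polynomial.eval_comp, hn']
  rw [h2, flowAt_natCast hg, compIter_one]

end Flow

/-! ### Ultrametric bounds and convergence -/

section Estimates

variable {K : Type*} [NormedField K]

lemma isLocallyAnalytic_of_norm_coeff_le {f : K⟦X⟧} {r : ℝ} (hr : 0 ≤ r)
    (h : ∀ n, ‖coeff n f‖ ≤ r ^ n) : IsLocallyAnalytic f := by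
  rw [IsLocallyAnalytic, radius, ENNReal.inv_pos]
  refine ne_top_of_le_ne_top (ENNReal.ofReal_ne_top (r := r)) ?_
  refine limsup_le_of_le (by isBoundedDefault) ?_
  filter_upwards [eventually_ne_atTop 0] with n hn
  have h1 : ‖coeff n f‖ₑ ≤ ENNReal.ofReal r ^ n := by
    rw [← ofReal_norm, ← ENNReal.ofReal_pow hr]
    exact ENNReal.ofReal_le_ofReal (h n)
  calc ‖coeff n f‖ₑ ^ (1 / (n : ℝ)) ≤ (ENNReal.ofReal r ^ n) ^ (1 / (n : ℝ)) :=
        ENNReal.rpow_le_rpow h1 (by positivity)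
    _ = ENNReal.ofReal r := by
        rw [one_div, ENNReal.pow_rpow_inv_natCast hn]

lemma IsLocallyAnalytic.exists_norm_coeff_le {f : K⟦X⟧} (hf : IsLocallyAnalytic f) :
    ∃ r : ℝ, 1 ≤ r ∧ ∀ n ≠ 0, ‖coeff n f‖ ≤ r ^ n := by
  rw [IsLocallyAnalytic, radius, ENNReal.inv_pos] at hf
  obtain ⟨b, hb, hb'⟩ := exists_between hf.lt_top
  obtain ⟨N, hN⟩ := eventually_atTop.1 (eventually_lt_of_limsup_lt hb (by isBoundedDefault))
  set M : ℝ := ∑ n ∈ Finset.range N, ‖coeff n f‖ with hM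
  have hM0 : 0 ≤ M := Finset.sum_nonneg fun _ _ => norm_nonneg _
  refine ⟨1 + b.toReal + M, by have := b.toReal_nonneg; linarith, fun n hn => ?_⟩
  have hb0 := b.toReal_nonneg
  rcases lt_or_ge n N with h | h
  · calc ‖coeff n f‖ ≤ M := Finset.single_le_sum (f := fun n => ‖coeff n f‖)
          (fun _ _ => norm_nonneg _) (Finset.mem_range.2 h)
      _ ≤ 1 + b.toReal + M := by linarith
      _ ≤ _ := le_self_pow₀ (by linarith) hn
  · have h1 : ‖coeff n f‖ₑ ≤ b ^ n := by
      have := ENNReal.rpow_le_rpow (hN n h).le (Nat.cast_nonneg n)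
      rwa [← ENNReal.rpow_mul, one_div, inv_mul_cancel₀ (Nat.cast_ne_zero.2 hn),
        ENNReal.rpow_one, ENNReal.rpow_natCast] at this
    have h2 : ‖coeff n f‖ ≤ b.toReal ^ n := by
      rw [← toReal_enorm, ← ENNReal.toReal_pow]
      exact ENNReal.toReal_mono (ENNReal.pow_ne_top hb'.ne) h1
    exact h2.trans (pow_le_pow_left₀ hb0 (by linarith) n)

/-- The extra factor r makes f map the disc of radius 1/r into itself. Squaring the initial r
absorbs it in degrees at least 2. -/
lemma IsLocallyAnalytic.exists_norm_coeff_mul_le {f : K⟦X⟧} (hf : IsLocallyAnalytic f)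
    (ht : IsTangentToId f) : ∃ r : ℝ, 1 ≤ r ∧ ∀ n, ‖coeff n f‖ * r ≤ r ^ n := by
  obtain ⟨r, hr, h⟩ := hf.exists_norm_coeff_le
  refine ⟨r ^ 2, one_le_pow₀ hr, fun n => ?_⟩
  rcases n with _ | _ | n
  · simp [ht.1]
  · simp [ht.2]
  · calc ‖coeff (n + 2) f‖ * r ^ 2 ≤ r ^ (n + 2) * r ^ 2 :=
          mul_le_mul_of_nonneg_right (h _ (by omega)) (by positivity)
      _ = r ^ (n + 4) := by ring
      _ ≤ r ^ (2 * (n + 2)) := pow_le_pow_right₀ hr (by omega)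
      _ = _ := by rw [pow_mul]

variable [IsUltrametricDist K]

lemma norm_sub_le_max (x y : K) : ‖x - y‖ ≤ max ‖x‖ ‖y‖ := by
  simpa [sub_eq_add_neg] using IsUltrametricDist.norm_add_le_max x (-y)

lemma norm_coeff_mul_le {φ ψ : K⟦X⟧} {r a b : ℝ} (hr : 0 ≤ r) (ha : 0 < a) (hb : 0 < b)
    (hφ : ∀ n, ‖coeff n φ‖ * a ≤ r ^ n) (hψ : ∀ n, ‖coeff n ψ‖ * b ≤ r ^ n) (n : ℕ) :
    ‖coeff n (φ * ψ)‖ * (a * b) ≤ r ^ n := by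
  rw [← le_div_iff₀ (mul_pos ha hb), coeff_mul]
  refine IsUltrametricDist.norm_sum_le_of_forall_le_of_nonneg (by positivity) fun p hp => ?_
  rw [le_div_iff₀ (mul_pos ha hb), norm_mul, ← Finset.HasAntidiagonal.mem_antidiagonal.1 hp, pow_add]
  calc ‖coeff p.1 φ‖ * ‖coeff p.2 ψ‖ * (a * b)
      = (‖coeff p.1 φ‖ * a) * (‖coeff p.2 ψ‖ * b) := by ring
    _ ≤ _ := mul_le_mul (hφ _) (hψ _) (by positivity) (by positivity)

lemma norm_coeff_pow_le {f : K⟦X⟧} {r : ℝ} (hr : 0 < r) (hf : ∀ n, ‖coeff n f‖ * r ≤ r ^ n)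
    (j n : ℕ) : ‖coeff n (f ^ j)‖ * r ^ j ≤ r ^ n := by
  induction j generalizing n with
  | zero =>
    rcases eq_or_ne n 0 with rfl | hn
    · simp
    · simp [coeff_one, hn, hr.le]
  | succ j ih =>
    rw [pow_succ, pow_succ]
    exact norm_coeff_mul_le hr.le (pow_pos hr j) hr ih hf n

lemma norm_coeff_comp_le {φ f : K⟦X⟧} (h0 : coeff 0 f = 0) {r : ℝ} (hr : 0 < r)
    (hf : ∀ n, ‖coeff n f‖ * r ≤ r ^ n) (hφ : ∀ n, ‖coeff n φ‖ ≤ r ^ n) (n : ℕ) :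
    ‖coeff n (comp φ f)‖ ≤ r ^ n := by
  rw [comp, coeff_subst' (hasSubst_of_coeff_zero h0)]
  refine finsum_induction (fun x : K => ‖x‖ ≤ r ^ n) (by simpa using by positivity)
    (fun x y hx hy => (IsUltrametricDist.norm_add_le_max x y).trans (max_le hx hy)) fun j => ?_
  rw [smul_eq_mul, norm_mul, mul_comm]
  exact (mul_le_mul_of_nonneg_left (hφ j) (norm_nonneg _)).trans (norm_coeff_pow_le hr hf j n)

lemma norm_coeff_diffOp_pow_X_le {f : K⟦X⟧} (h0 : coeff 0 f = 0) {r : ℝ} (hr : 1 ≤ r)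
    (hf : ∀ n, ‖coeff n f‖ * r ≤ r ^ n) (k n : ℕ) :
    ‖coeff n ((diffOp h0 ^ k) X)‖ ≤ r ^ n := by
  have hr0 : 0 < r := by linarith
  induction k generalizing n with
  | zero =>
    rw [pow_zero, Module.End.one_apply, coeff_X]
    split_ifs with h
    · simpa [h] using hr
    · simpa using by positivity
  | succ k ih =>
    rw [pow_succ' (diffOp h0), Module.End.mul_apply, diffOp_apply, map_sub]
    exact (norm_sub_le_max _ _).trans
      (max_le (norm_coeff_comp_le h0 hr0 hf ih n) (ih n))

lemma exists_prime_norm_natCast_eq_one (K : Type*) [NormedField K] [IsUltrametricDist K] :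
    ∃ p : ℕ, p.Prime ∧ ∀ a : ℕ, ¬ p ∣ a → ‖(a : K)‖ = 1 := by
  by_cases H : ∃ p : ℕ, p.Prime ∧ ‖(p : K)‖ < 1
  · obtain ⟨p, hp, hp1⟩ := H
    refine ⟨p, hp, fun a ha => (IsUltrametricDist.norm_natCast_le_one K a).antisymm ?_⟩
    by_contra! hlt
    have hcop : IsCoprime (p : ℤ) (a : ℤ) :=
      Nat.isCoprime_iff_coprime.2 ((Nat.Prime.coprime_iff_not_dvd hp).2 ha)
    obtain ⟨x, y, hxy⟩ := hcop
    have hxy' : (x : K) * p + y * a = 1 := by exact_mod_cast congrArg (Int.cast : ℤ → K) hxy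
    have h1 : ∀ (z : ℤ) (b : ℕ), ‖(b : K)‖ < 1 → ‖(z : K) * b‖ < 1 := fun z b hb => by
      rw [norm_mul]
      exact (mul_le_of_le_one_left (norm_nonneg _)
        (IsUltrametricDist.norm_intCast_le_one K z)).trans_lt hb
    have := (IsUltrametricDist.norm_add_le_max ((x : K) * p) (y * a)).trans_lt
      (max_lt (h1 x p hp1) (h1 y a hlt))
    rw [hxy', norm_one] at this
    exact lt_irrefl _ this
  · push Not at H
    -- Here every prime has norm 1, so any choice of prime works.
    refine ⟨2, Nat.prime_two, fun a ha => ?_⟩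
    have ha0 : a ≠ 0 := by rintro rfl; simp at ha
    clear ha
    induction a using induction_on_primes with
    | zero => exact absurd rfl ha0
    | one => simp
    | prime_mul p a hp ih =>
      rw [Nat.cast_mul, norm_mul, ih (right_ne_zero_of_mul ha0), mul_one]
      exact (IsUltrametricDist.norm_natCast_le_one K p).antisymm (H p hp)

/-- The prime-to-p part of k! has norm 1, and its p-adic valuation is at most k. -/
lemma exists_pow_le_norm_factorial (K : Type*) [NormedField K] [IsUltrametricDist K]
    [CharZero K] : ∃ c : ℝ, 0 < c ∧ ∀ k : ℕ, c ^ k ≤ ‖(k.factorial : K)‖ := by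
  obtain ⟨p, hp, h⟩ := exists_prime_norm_natCast_eq_one K
  refine ⟨‖(p : K)‖, norm_pos_iff.2 (Nat.cast_ne_zero.2 hp.ne_zero), fun k => ?_⟩
  have : Fact p.Prime := ⟨hp⟩
  have e := Nat.ordProj_mul_ordCompl_eq_self k.factorial p
  rw [← e, Nat.cast_mul, norm_mul, h _ (Nat.not_dvd_ordCompl hp k.factorial_ne_zero), mul_one,
    Nat.cast_pow, norm_pow, Nat.factorization_def _ hp]
  exact pow_le_pow_of_le_one (norm_nonneg _) (IsUltrametricDist.norm_natCast_le_one K p)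
    (padicValNat_factorial_le p k)

lemma norm_descPochhammer_eval_le (t : K) (k : ℕ) :
    ‖(descPochhammer K k).eval t‖ ≤ max ‖t‖ 1 ^ k := by
  induction k with
  | zero => simp
  | succ k ih =>
    rw [descPochhammer_succ_right, Polynomial.eval_mul, norm_mul, pow_succ]
    refine mul_le_mul ih ?_ (norm_nonneg _) (by positivity)
    simpa using (norm_sub_le_max t (k : K)).trans
      (max_le_max le_rfl (IsUltrametricDist.norm_natCast_le_one K k))

lemma isLocallyAnalytic_flowAt [CharZero K] {f : K⟦X⟧} (hf : IsLocallyAnalytic f)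
    (ht : IsTangentToId f) (t : K) : IsLocallyAnalytic (flowAt ht.1 t) := by
  obtain ⟨r, hr, h⟩ := hf.exists_norm_coeff_mul_le ht
  obtain ⟨c, hc, hfac⟩ := exists_pow_le_norm_factorial K
  -- The maximum with 1 allows sᵏ ≤ sⁿ for k < n.
  set s : ℝ := max (max ‖t‖ 1 / c) 1 with hs
  have hs1 : 1 ≤ s := le_max_right _ _
  refine isLocallyAnalytic_of_norm_coeff_le (r := r * s) (by positivity) fun n => ?_
  rw [coeff_flowAt, mul_pow]
  refine IsUltrametricDist.norm_sum_le_of_forall_le_of_nonneg (by positivity) fun k hk => ?_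
  rw [div_mul_eq_mul_div, mul_div_assoc, norm_mul, norm_div]
  refine mul_le_mul (norm_coeff_diffOp_pow_X_le ht.1 hr h k n) ?_ (by positivity) (by positivity)
  calc ‖(descPochhammer K k).eval t‖ / ‖(k.factorial : K)‖ ≤ max ‖t‖ 1 ^ k / c ^ k :=
        div_le_div₀ (by positivity) (norm_descPochhammer_eval_le t k) (by positivity) (hfac k)
    _ = (max ‖t‖ 1 / c) ^ k := by rw [div_pow]
    _ ≤ s ^ k := pow_le_pow_left₀ (by positivity) (le_max_left _ _) k
    _ ≤ s ^ n := pow_le_pow_right₀ hs1 (Finset.mem_range.1 hk).le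

end Estimates

lemma HasReducedForm.isTangentToId {R : Type*} [CommRing R] {m : ℕ} (hm : 2 ≤ m) {μ : R}
    {f : R⟦X⟧} (hf : HasReducedForm m μ f) : IsTangentToId f := by
  obtain ⟨r, rfl⟩ := hf
  have key : ∀ i < 2, coeff i (X + X ^ m + C μ * X ^ (2 * m - 1) + X ^ (2 * m) * r) =
      coeff i (X : R⟦X⟧) := fun i hi => by
    rw [map_add, map_add, map_add, coeff_X_pow, if_neg (by omega), coeff_C_mul, coeff_X_pow,
      if_neg (by omega), coeff_X_pow_mul', if_neg (by omega)]
    simp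
  exact ⟨by simp [key 0], by simp [key 1]⟩

end NonarchRoots

theorem mainTheorem5 {K : Type*} [NontriviallyNormedField K] [IsUltrametricDist K]
    [CompleteSpace K] [CharZero K] (m : ℕ) (hm : 2 ≤ m) (μ : K) (f : PowerSeries K)
    (hf : NonarchRoots.IsLocallyAnalytic f) (hform : NonarchRoots.HasReducedForm m μ f)
    (n : ℕ) (hn : 1 ≤ n) :
    ∃! g : PowerSeries K, NonarchRoots.IsLocallyAnalytic g ∧ NonarchRoots.IsTangentToId g ∧
      NonarchRoots.compIter g n = f := by
  have ht := hform.isTangentToId hm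
  have hn0 : n ≠ 0 := by omega
  refine ⟨NonarchRoots.flowAt ht.1 (1 / (n : K)),
    ⟨NonarchRoots.isLocallyAnalytic_flowAt hf ht _, NonarchRoots.isTangentToId_flowAt ht.1 _, ?_⟩,
    fun g hg => NonarchRoots.eq_flowAt_of_compIter_eq ht hg.2.1 hn0 hg.2.2⟩
  rw [NonarchRoots.compIter_flowAt ht, one_div, inv_mul_cancel₀ (Nat.cast_ne_zero.2 hn0)]
  simpa [NonarchRoots.compIter_one] using NonarchRoots.flowAt_natCast ht 1
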